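/- Notation. For an integer $N\ge 1$ let $\mathbb Z_N=\{0,\dots,N-1\}$ and let $\ell^2_N=\ell^2(\mathbb Z_N)$ be the space of functions $u:\mathbb Z_N\to\mathbb C$ with $\|u\|^2=\sum_{j}|u(j)|^2$. Let $\mathcal F_N$ be the unitary Fourier transform on $\ell^2_N$, with matrix $\frac1{\sqrt N}\big(e^{-2\pi i j\ell/N}\big)_{j,\ell\in\mathbb Z_N}$. For $X\subset\mathbb Z_N$ let $\mathbf 1_X$ be multiplication by the indicator function of $X$. Given $M\in\mathbb N$, an alphabet $\mathcal A\subset\{0,\dots,M-1\}$, a cutoff $\chi\in C_0^\infty((0,1);[0,1])$ and a positive multiple $N$ of $M$, let $\chi_{N/M}$ be multiplication by $\chi\big(\tfrac{\ell}{N/M}\big)$ on $\ell^2_{N/M}$, let $I_{\mathcal A,M}$ be the diagonal $N\times N$ matrix whose $\ell$-th diagonal entry is $1$ if $\lfloor \ell/(N/M)\rfloor\in\mathcal A$ and $0$ otherwise, and define the open quantum baker's map $$ B_N=\mathcal F_N^*\begin{pmatrix}\chi_{N/M}\mathcal F_{N/M}\chi_{N/M}&&\\&\ddots&\\&&\chi_{N/M}\mathcal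 F_{N/M}\chi_{N/M}\end{pmatrix}I_{\mathcal A,M}:\ell^2_N\to\ell^2_N $$ (with $M$ diagonal blocks). For $k\in\mathbb N$ with $M^k\le N<M^{k+1}$ put $$ \mathcal C_k=\Big\{\sum_{i=0}^{k-1}a_iM^i : a_0,\dots,a_{k-1}\in\mathcal A\Big\},\qquad \mathcal C_k(N)=\Big\{\Big\lceil\frac{jN}{M^k}\Big\rceil : j\in\mathcal C_k\Big\}\subset\mathbb Z_N . $$ Proposition (localization of eigenstates). Let $\nu>0$, $\rho\in(0,1)$ and $\chi\in C_0^\infty((0,1);[0,1])$. For every $n\in\mathbb N$ there is a constant $C$, depending only on $\nu,\rho,\chi,n$, such that the following holds for all $M\in\mathbb N$, $\mathcal A\subset\{0,\dots,M-1\}$, $k\in\mathbb N$, $N\in M\mathbb Z\cap[M^k,M^{k+1})$, $\lambda\in\mathbb C$ and $u\in\ell^2_N$ with $$ B_Nu=\lambda u,\qquad |\lambda|\ge M^{-\nu}. $$ Set $$ X_\rho=\bigcup\big\{\mathcal C_k(N)+m : m\in\mathbb Z,\ |m|\le (M+2)N^{1-\rho}\big\}\subset\mathbb Z_N, $$ where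 the translates are taken modulo $N$. Then $$ \|u\|\le M^\nu|\lambda|^{-\rho k}\,\|\mathbf 1_{X_\rho}u\|+CN^{-n}\|u\|, \qquad \|u-\mathcal F_N^*\mathbf 1_{X_\rho}\mathcal F_Nu\|\le CN^{-n}\|u\|. $$ -/

import Mathlib

namespace OpenBaker

/-- The space `ℓ²_N` of functions on `ℤ_N = {0, …, N-1}`, with norm
`‖u‖² = ∑ |u(j)|²`. -/
abbrev ell2 (N : ℕ) : Type := EuclideanSpace ℂ (Fin N)

/-- The kernel `N^{-1/2} exp(-2πi a b / N)` of the unitary Fourier transform. -/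
noncomputable def dftKernel (N a b : ℕ) : ℂ :=
  ((1 / Real.sqrt (N : ℝ) : ℝ) : ℂ) *
    Complex.exp (-(2 * (Real.pi : ℂ) * Complex.I * (a : ℂ) * (b : ℂ)) / (N : ℂ))

/-- The unitary discrete Fourier transform `𝓕_N` as a matrix. -/
noncomputable def dft (N : ℕ) : Matrix (Fin N) (Fin N) ℂ :=
  Matrix.of fun j l => dftKernel N (j : ℕ) (l : ℕ)

/-- The discretization `χ_L(a) = χ(a / L)` of a function `χ` on the real line. -/
noncomputable def discretize (χ : ℝ → ℝ) (L a : ℕ) : ℂ :=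
  ((χ ((a : ℝ) / (L : ℝ)) : ℝ) : ℂ)

/-- The block diagonal `N × N` matrix consisting of `M` copies of the block
`χ_L 𝓕_L χ_L`, where `L = N / M` (with `N` a multiple of `M`): the index `j` lies in the block
number `⌊j / L⌋`, at the position `j mod L`. -/
noncomputable def blockMatrix (M N : ℕ) (χ : ℝ → ℝ) : Matrix (Fin N) (Fin N) ℂ :=
  Matrix.of fun i j =>
    if (i : ℕ) / (N / M) = (j : ℕ) / (N / M) then
      discretize χ (N / M) ((i : ℕ) % (N / M)) *
        dftKernel (N / M) ((i : ℕ) % (N / M)) ((j : ℕ) % (N / M)) *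
        discretize χ (N / M) ((j : ℕ) % (N / M))
    else 0

/-- The diagonal matrix `I_{𝒜,M}`: its `l`-th diagonal entry is `1` if `⌊l / (N/M)⌋ ∈ 𝒜` and
`0` otherwise. -/
def alphabetMatrix (M N : ℕ) (A : Finset ℕ) : Matrix (Fin N) (Fin N) ℂ :=
  Matrix.diagonal fun l => if (l : ℕ) / (N / M) ∈ A then 1 else 0

/-- The open quantum baker's map `B_N` with base `M`, alphabet `𝒜` and cutoff `χ`. -/
noncomputable def bakerMatrix (M N : ℕ) (A : Finset ℕ) (χ : ℝ → ℝ) :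
    Matrix (Fin N) (Fin N) ℂ :=
  (dft N).conjTranspose * blockMatrix M N χ * alphabetMatrix M N A

/-- The discrete Cantor set `𝒞_k = {∑_{i<k} a_i M^i : a_i ∈ 𝒜}`. -/
def cantor (M : ℕ) (A : Finset ℕ) (k : ℕ) : Set ℕ :=
  {n | ∃ a : Fin k → ℕ, (∀ i, a i ∈ A) ∧ n = ∑ i, a i * M ^ (i : ℕ)}

/-- The point `b_j(N) = ⌈j N / M^k⌉`. -/
noncomputable def cantorPoint (M N k j : ℕ) : ℕ :=
  ⌈((j : ℝ) * (N : ℝ)) / (M : ℝ) ^ k⌉₊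

/-- The discrete Cantor set `𝒞_k(N) = {b_j(N) : j ∈ 𝒞_k}` in `ℤ_N`. -/
def cantorN (M N : ℕ) (A : Finset ℕ) (k : ℕ) : Set (Fin N) :=
  {l | ∃ j ∈ cantor M A k, (l : ℕ) = cantorPoint M N k j}

/-- The union `X_ρ` of the translates `𝒞_k(N) + m` modulo `N`, over all integers `m` with
`|m| ≤ (M + 2) N^{1-ρ}`. -/
def thickened (M N : ℕ) (A : Finset ℕ) (k : ℕ) (ρ : ℝ) : Set (Fin N) :=
  {l | ∃ c ∈ cantorN M N A k, ∃ m : ℤ,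
    |(m : ℝ)| ≤ ((M : ℝ) + 2) * (N : ℝ) ^ (1 - ρ) ∧
      ((l : ℕ) : ℤ) ≡ ((c : ℕ) : ℤ) + m [ZMOD (N : ℤ)]}

/-- Multiplication by the indicator function of `X`. -/
noncomputable def cutTo {N : ℕ} (X : Set (Fin N)) (u : ell2 N) : ell2 N :=
  WithLp.toLp 2 (X.indicator u.ofLp)

end OpenBaker

namespace OpenBaker

/-! Write `L = N / M`. The matrix `B_N` quantizes the expanding map `x ↦ Mx mod 1`, opened by the
alphabet. Its entry `(j, l)` vanishes unless `⌊l / L⌋ ∈ A`; otherwise it is, up to harmless factors,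
an exponential sum with weights `χ(r / L)` and frequency `j / N - (l mod L) / L`. Repeated summation
by parts makes it rapidly small when that frequency is much larger than `1 / L`
(`exists_norm_bakerMatrix_apply_le`). The cutoff keeps away from the ends of the unit interval, so
no wrap-around occurs.

Let `t = ⌈ρ k⌉` and allow an error `M N^{-ρ}` in each step, that is, `N^{1-ρ}` in units of `1 / L`.
Then `B^t` is negligible on states supported off `orbitSet`, the points that can be propagated for
`t` steps (`norm_bakerMatrix_pow_mul_cut_le`). Going backwards the map contracts by `M`, so the
errors form a geometric series with sum at most `2 N^{-ρ}`. Such points are therefore this close to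
a Cantor cylinder of length `M^{-t} ≤ M N^{-ρ}`, hence lie in `X_ρ` (`orbitSet_subset_thickened`).

For an eigenstate, `u = λ^{-t} B^t u`. Cutting on the right of `B^t` gives the first estimate. For
the second, `B = F* D` with `D` symmetric, so `F B F* = Bᵀ`: the cut on the left of `F B^t` becomes
the transpose of the same negligible operator (`norm_pow_mul_norm_sub_le`). All losses, including
`|λ|^{-t} ≤ N^ν`, are polynomial in `N` and are absorbed by the order of summation by parts. -/

/-! ### Finite differences and decay of smooth exponential sums. -/

theorem hasDerivAt_fwdDiff_iter {f : ℝ → ℝ} (hf : Differentiable ℝ f) (h : ℝ) (m : ℕ) (x : ℝ) :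
    HasDerivAt ((fwdDiff h)^[m] f) ((fwdDiff h)^[m] (deriv f) x) x := by
  induction m generalizing x with
  | zero => exact (hf x).hasDerivAt
  | succ m ih =>
    rw [Function.iterate_succ_apply', Function.iterate_succ_apply']
    have h1 : HasDerivAt (fun y => (fwdDiff h)^[m] f (y + h)) ((fwdDiff h)^[m] (deriv f) (x + h)) x :=
      (ih (x + h)).comp_add_const x h
    exact h1.sub (ih x)

/-- By the mean value inequality, each difference trades one derivative for a factor `|h|`. -/
theorem abs_fwdDiff_iter_le {C h : ℝ} (m : ℕ) {f : ℝ → ℝ}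
    (hf : ContDiff ℝ ((⊤ : ℕ∞) : WithTop ℕ∞) f) (hC : ∀ x, |iteratedDeriv m f x| ≤ C) (x : ℝ) :
    |(fwdDiff h)^[m] f x| ≤ C * |h| ^ m := by
  induction m generalizing f x with
  | zero => simpa using hC x
  | succ m ih =>
    have hf' : ContDiff ℝ ((⊤ : ℕ∞) : WithTop ℕ∞) (deriv f) :=
      ((contDiff_infty_iff_deriv).1 hf).2
    have hd : Differentiable ℝ f := hf.differentiable (by simp)
    have hb : ∀ y, ‖(fwdDiff h)^[m] (deriv f) y‖ ≤ C * |h| ^ m := fun y =>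
      ih hf' (fun z => by simpa [iteratedDeriv_succ'] using hC z) y
    have := Convex.norm_image_sub_le_of_norm_hasDerivWithin_le (s := Set.univ)
      (f := (fwdDiff h)^[m] f) (x := x) (y := x + h)
      (fun y _ => (hasDerivAt_fwdDiff_iter hd h m y).hasDerivWithinAt) (fun y _ => hb y)
      convex_univ (Set.mem_univ _) (Set.mem_univ _)
    rw [Function.iterate_succ_apply']
    simpa [fwdDiff, pow_succ, mul_assoc] using this

theorem fwdDiff_iter_eq_zero {f : ℝ → ℝ} (hf : ∀ x, f x ≠ 0 → x ∈ Set.Icc (0 : ℝ) 1) {h : ℝ}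
    (hh : 0 ≤ h) (m : ℕ) (x : ℝ) (hx : (fwdDiff h)^[m] f x ≠ 0) : x ∈ Set.Icc (-(m * h)) 1 := by
  induction m generalizing x with
  | zero => simpa using hf x hx
  | succ m ih =>
    rw [Function.iterate_succ_apply'] at hx
    by_cases h1 : (fwdDiff h)^[m] f (x + h) = 0
    · have h2 : (fwdDiff h)^[m] f x ≠ 0 := fun h2 => hx (by simp [fwdDiff, h1, h2])
      obtain ⟨h3, h4⟩ := ih x h2
      push_cast
      exact ⟨by nlinarith, h4⟩
    · obtain ⟨h3, h4⟩ := ih _ h1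
      push_cast
      exact ⟨by nlinarith, by linarith⟩

/-- The sum `∑ g(i h) zⁱ` over all integers. -/
noncomputable def latticeSum (h : ℝ) (z : ℂ) (g : ℝ → ℝ) : ℂ :=
  ∑' i : ℤ, (g (i * h) : ℂ) * z ^ i

theorem summable_latticeSum {h a b : ℝ} (hh : 0 < h) (z : ℂ) {g : ℝ → ℝ}
    (hg : ∀ x, g x ≠ 0 → x ∈ Set.Icc a b) :
    Summable fun i : ℤ => (g (i * h) : ℂ) * z ^ i := by
  refine summable_of_hasFiniteSupport ((Set.finite_Icc ⌈a / h⌉ ⌊b / h⌋).subset ?_)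
  intro i hi
  have h1 : g (i * h) ≠ 0 := fun h0 => hi (by simp [h0])
  obtain ⟨h2, h3⟩ := hg _ h1
  exact ⟨Int.ceil_le.2 ((div_le_iff₀ hh).2 h2), Int.le_floor.2 ((le_div_iff₀ hh).2 h3)⟩

/-- Summation by parts: shifting the index of a finitely supported sum over `ℤ` produces the factor
`z⁻¹` and no boundary terms. -/
theorem latticeSum_fwdDiff {h a b : ℝ} (hh : 0 < h) {z : ℂ} (hz : z ≠ 0) {g : ℝ → ℝ}
    (hg : ∀ x, g x ≠ 0 → x ∈ Set.Icc a b) :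
    latticeSum h z (fwdDiff h g) = (z⁻¹ - 1) * latticeSum h z g := by
  have hs := summable_latticeSum hh z hg
  have h1 : ∀ i : ℤ, (g (i * h + h) : ℂ) * z ^ i
      = z⁻¹ * (fun j : ℤ => (g (j * h) : ℂ) * z ^ j) (Equiv.addRight (1 : ℤ) i) := by
    intro i
    simp only [Equiv.coe_addRight, zpow_add₀ hz]
    push_cast
    rw [add_mul, one_mul]
    field_simp
  have hs1 : Summable fun i : ℤ => (g (i * h + h) : ℂ) * z ^ i := by
    simp_rw [h1]
    exact (((Equiv.addRight (1 : ℤ)).summable_iff).2 hs).mul_left _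
  unfold latticeSum
  simp only [fwdDiff, Complex.ofReal_sub, sub_mul]
  rw [hs1.tsum_sub hs, one_mul]
  congr 1
  simp_rw [h1]
  rw [tsum_mul_left, Equiv.tsum_eq (Equiv.addRight (1 : ℤ)) fun j : ℤ => (g (j * h) : ℂ) * z ^ j]

theorem latticeSum_fwdDiff_iter {h : ℝ} (hh : 0 < h) {z : ℂ} (hz : z ≠ 0) {g : ℝ → ℝ}
    (hg : ∀ x, g x ≠ 0 → x ∈ Set.Icc (0 : ℝ) 1) (m : ℕ) :
    latticeSum h z ((fwdDiff h)^[m] g) = (z⁻¹ - 1) ^ m * latticeSum h z g := by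
  induction m with
  | zero => simp
  | succ m ih =>
    rw [Function.iterate_succ_apply',
      latticeSum_fwdDiff hh hz (fwdDiff_iter_eq_zero hg hh.le m), ih, pow_succ]
    ring

theorem latticeSum_eq_sum_range {L : ℕ} (hL : 0 < L) (z : ℂ) {g : ℝ → ℝ}
    (hg : ∀ x, g x ≠ 0 → x ∈ Set.Ioo (0 : ℝ) 1) :
    latticeSum (L : ℝ)⁻¹ z g = ∑ i ∈ Finset.range L, (g ((i : ℝ) / L) : ℂ) * z ^ i := by
  have hL' : (0 : ℝ) < L := by exact_mod_cast hL
  have := tsum_eq_sum (L := SummationFilter.unconditional ℤ) (f := fun i : ℤ => (g (i * (L : ℝ)⁻¹) : ℂ) * z ^ i)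
    (s := (Finset.range L).map Nat.castEmbedding) ?_
  · rw [latticeSum, this, Finset.sum_map]
    simp [div_eq_mul_inv]
  · intro i hi
    by_contra hne
    have h1 : g (i * (L : ℝ)⁻¹) ≠ 0 := fun h0 => hne (by simp [h0])
    obtain ⟨h2, h3⟩ := hg _ h1
    rw [← div_eq_mul_inv] at h2 h3
    rw [div_lt_one hL'] at h3
    have h4 : (0 : ℝ) < i := by
      by_contra hc
      exact absurd h2 (not_lt.2 (div_nonpos_of_nonpos_of_nonneg (not_lt.1 hc) hL'.le))
    have h5 : (0 : ℤ) < i := by exact_mod_cast h4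
    have h6 : i < (L : ℤ) := by exact_mod_cast h3
    apply hi
    simp only [Finset.mem_map, Finset.mem_range, Nat.castEmbedding_apply]
    exact ⟨i.toNat, by omega, by omega⟩

theorem norm_latticeSum_le {L : ℕ} (hL : 0 < L) {z : ℂ} (hz : ‖z‖ = 1) {g : ℝ → ℝ} {m : ℕ} {B : ℝ}
    (hg : ∀ x, g x ≠ 0 → x ∈ Set.Icc (-(m * (L : ℝ)⁻¹)) 1) (hB : ∀ x, |g x| ≤ B) :
    ‖latticeSum (L : ℝ)⁻¹ z g‖ ≤ (m + 2) * L * B := by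
  have hL' : (0 : ℝ) < L := by exact_mod_cast hL
  have hB0 : 0 ≤ B := (abs_nonneg _).trans (hB 0)
  have := tsum_eq_sum (L := SummationFilter.unconditional ℤ) (f := fun i : ℤ => (g (i * (L : ℝ)⁻¹) : ℂ) * z ^ i)
    (s := Finset.Icc (-(m : ℤ)) L) ?_
  · rw [latticeSum, this]
    refine (norm_sum_le_of_le (f := fun i : ℤ => (g (i * (L : ℝ)⁻¹) : ℂ) * z ^ i)
      _ (n := fun _ => B) fun i _ => ?_).trans ?_
    · simpa [hz] using hB _
    · simp only [Finset.sum_const, Int.card_Icc, nsmul_eq_mul]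
      refine mul_le_mul_of_nonneg_right ?_ hB0
      have h1 : (((L : ℤ) + 1 - -(m : ℤ)).toNat : ℝ) = L + 1 + m := by
        have : ((L : ℤ) + 1 - -(m : ℤ)).toNat = L + 1 + m := by omega
        rw [this]; push_cast; ring
      have h2 : (1 : ℝ) ≤ L := by exact_mod_cast hL
      rw [h1]
      nlinarith [(Nat.cast_nonneg m : (0 : ℝ) ≤ m)]
  · intro i hi
    by_contra hne
    have h1 : g (i * (L : ℝ)⁻¹) ≠ 0 := fun h0 => hne (by simp [h0])
    obtain ⟨h2, h3⟩ := hg _ h1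
    rw [← neg_mul, mul_le_mul_iff_left₀ (inv_pos.2 hL')] at h2
    rw [← div_eq_mul_inv, div_le_one hL'] at h3
    exact hi (Finset.mem_Icc.2 ⟨by exact_mod_cast h2, by exact_mod_cast h3⟩)

/-- The left side is `2 |sin (π θ)|`. Jordan's inequality is used near `0` and, after reflection,
near `π`; the margin `δ` keeps `|θ|` away from the next zero at `1`. -/
theorem le_norm_exp_sub_one {δ θ : ℝ} (hδ0 : 0 ≤ δ) (hδ1 : δ ≤ 1) (hθ : |θ| ≤ 1 - δ) :
    4 * δ * |θ| ≤ ‖Complex.exp (Complex.I * ((2 * Real.pi * θ : ℝ) : ℂ)) - 1‖ := by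
  rw [Complex.norm_exp_I_mul_ofReal_sub_one, Real.norm_eq_abs, abs_mul, abs_two]
  have e : 2 * Real.pi * θ / 2 = Real.pi * θ := by ring
  rw [e]
  have hπ := Real.pi_pos
  have key : ∀ t : ℝ, 0 ≤ t → t ≤ 1 - δ → 2 * δ * t ≤ Real.sin (Real.pi * t) := by
    intro t ht0 ht1
    rcases le_total t (1 / 2) with h | h
    · have := Real.mul_le_sin (x := Real.pi * t) (by positivity) (by nlinarith)
      have e2 : 2 / Real.pi * (Real.pi * t) = 2 * t := by field_simp
      rw [e2] at this
      nlinarith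
    · have := Real.mul_le_sin (x := Real.pi * (1 - t)) (mul_nonneg hπ.le (by nlinarith))
        (by nlinarith)
      have e2 : 2 / Real.pi * (Real.pi * (1 - t)) = 2 * (1 - t) := by field_simp
      rw [e2, show Real.pi * (1 - t) = Real.pi - Real.pi * t by ring, Real.sin_pi_sub] at this
      nlinarith
  have h1 := key |θ| (abs_nonneg _) hθ
  have h2 : Real.sin (Real.pi * |θ|) ≤ |Real.sin (Real.pi * θ)| := by
    rcases abs_choice θ with h | h <;> rw [h]
    · exact le_abs_self _
    · rw [mul_neg, Real.sin_neg]; exact neg_le_abs _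
  linarith

theorem exists_margin {χ : ℝ → ℝ} (hχ_supp : tsupport χ ⊆ Set.Ioo (0 : ℝ) 1) :
    ∃ δ : ℝ, 0 < δ ∧ δ ≤ 1 ∧ ∀ x, χ x ≠ 0 → δ ≤ x ∧ x ≤ 1 - δ := by
  have hc : IsCompact (tsupport χ) :=
    isCompact_Icc.of_isClosed_subset (isClosed_tsupport χ) (hχ_supp.trans Set.Ioo_subset_Icc_self)
  obtain ⟨δ, hδ, hsub⟩ := hc.exists_cthickening_subset_open isOpen_Ioo hχ_supp
  refine ⟨min δ 1, lt_min hδ one_pos, min_le_right _ _, fun x hx => ?_⟩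
  have hx' : x ∈ tsupport χ := subset_tsupport _ hx
  have key : ∀ y, |y - x| ≤ δ → y ∈ Set.Ioo (0 : ℝ) 1 := fun y hy =>
    hsub (Metric.mem_cthickening_of_dist_le y x δ _ hx' (by rwa [Real.dist_eq]))
  have h1 := (key (x - δ) (by simp [abs_of_pos hδ])).1
  have h2 := (key (x + δ) (by simp [abs_of_pos hδ])).2
  have := min_le_left δ 1
  constructor <;> linarith

/-- Rapid decay of the exponential sums `∑ χ(i/L) e^{2πi iθ}`, `θ = y - x`, off the diagonal. -/
theorem exists_norm_sum_le {χ : ℝ → ℝ} (hχ_smooth : ContDiff ℝ ((⊤ : ℕ∞) : WithTop ℕ∞) χ)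
    (hχ_supp : tsupport χ ⊆ Set.Ioo (0 : ℝ) 1) (m : ℕ) :
    ∃ K : ℝ, 0 ≤ K ∧ ∀ (L : ℕ), 0 < L → ∀ x y : ℝ, χ x ≠ 0 → y ∈ Set.Icc (0 : ℝ) 1 →
      (L * |y - x|) ^ m * ‖∑ i ∈ Finset.range L, (χ ((i : ℝ) / L) : ℂ) *
        Complex.exp (Complex.I * ((2 * Real.pi * (y - x) : ℝ) : ℂ)) ^ i‖ ≤ K * L := by
  obtain ⟨δ, hδ, hδ1, hmargin⟩ := exists_margin hχ_supp
  have hc : HasCompactSupport χ :=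
    isCompact_Icc.of_isClosed_subset (isClosed_tsupport χ) (hχ_supp.trans Set.Ioo_subset_Icc_self)
  have hcm : HasCompactSupport (iteratedDeriv m χ) := by
    have : ∀ m, HasCompactSupport (iteratedDeriv m χ) := by
      intro m
      induction m with
      | zero => simpa using hc
      | succ m ih => rw [iteratedDeriv_succ]; exact ih.deriv
    exact this m
  obtain ⟨C, hC⟩ := hcm.exists_bound_of_continuous
    (hχ_smooth.continuous_iteratedDeriv m (by exact_mod_cast le_top))
  have hC0 : 0 ≤ C := (norm_nonneg _).trans (hC 0)
  refine ⟨(m + 2) * C / (4 * δ) ^ m, by positivity, fun L hL x y hx hy => ?_⟩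
  have hL' : (0 : ℝ) < L := by exact_mod_cast hL
  set z := Complex.exp (Complex.I * ((2 * Real.pi * (y - x) : ℝ) : ℂ)) with hz
  have hz1 : ‖z‖ = 1 := by rw [hz, mul_comm]; exact Complex.norm_exp_ofReal_mul_I _
  have hz0 : z ≠ 0 := Complex.exp_ne_zero _
  have hsupp : ∀ x, χ x ≠ 0 → x ∈ Set.Ioo (0 : ℝ) 1 := fun x hx => hχ_supp (subset_tsupport _ hx)
  have hsupp' : ∀ x, χ x ≠ 0 → x ∈ Set.Icc (0 : ℝ) 1 :=
    fun x hx => Set.Ioo_subset_Icc_self (hsupp x hx)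
  have hh : (0 : ℝ) < (L : ℝ)⁻¹ := inv_pos.2 hL'
  rw [← latticeSum_eq_sum_range hL z hsupp]
  have h1 := norm_latticeSum_le hL hz1 (fwdDiff_iter_eq_zero hsupp' hh.le m)
    (abs_fwdDiff_iter_le (h := (L : ℝ)⁻¹) m hχ_smooth hC)
  rw [latticeSum_fwdDiff_iter hh hz0 hsupp' m, norm_mul, norm_pow, abs_of_pos hh] at h1
  have h2 : ‖z⁻¹ - 1‖ = ‖z - 1‖ := by
    have : z⁻¹ - 1 = -(z⁻¹ * (z - 1)) := by field_simp; ring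
    rw [this, norm_neg, norm_mul, norm_inv, hz1, inv_one, one_mul]
  -- Since `x ∈ [δ, 1 - δ]` and `y ∈ [0, 1]`, `|y - x| ≤ 1 - δ`: the distance on the line controls
  -- the phase without reduction modulo `1`.
  have h3 : 4 * δ * |y - x| ≤ ‖z - 1‖ := by
    obtain ⟨h4, h5⟩ := hmargin x hx
    exact le_norm_exp_sub_one hδ.le hδ1 (abs_le.2 ⟨by linarith [hy.1], by linarith [hy.2]⟩)
  rw [h2] at h1
  have h4 : (4 * δ * |y - x|) ^ m * ‖latticeSum (L : ℝ)⁻¹ z χ‖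
      ≤ (m + 2) * L * (C * (L : ℝ)⁻¹ ^ m) :=
    (mul_le_mul_of_nonneg_right (pow_le_pow_left₀ (by positivity) h3 m) (norm_nonneg _)).trans h1
  have h5 : 0 < (4 * δ) ^ m := by positivity
  have h6 : 0 < (L : ℝ) ^ m := by positivity
  rw [div_mul_eq_mul_div, le_div_iff₀ h5, mul_pow]
  rw [mul_pow, inv_pow] at h4
  calc _ = (L : ℝ) ^ m * ((4 * δ) ^ m * |y - x| ^ m * ‖latticeSum (L : ℝ)⁻¹ z χ‖) := by ring
    _ ≤ (L : ℝ) ^ m * ((m + 2) * L * (C * ((L : ℝ) ^ m)⁻¹)) :=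
      mul_le_mul_of_nonneg_left h4 h6.le
    _ = _ := by field_simp

/-! ### Unitarity of Fourier matrices and operator norm bounds. -/

open scoped Matrix.Norms.L2Operator

theorem dftKernel_comm (N a b : ℕ) : dftKernel N a b = dftKernel N b a := by
  unfold dftKernel
  congr 3
  ring

theorem sum_fin_mul {R : Type*} [AddCommMonoid R] (M L : ℕ) (f : ℕ → ℕ → R) :
    ∑ i : Fin (M * L), f ((i : ℕ) / L) ((i : ℕ) % L) = ∑ b : Fin M, ∑ r : Fin L, f b r := by
  rw [← Equiv.sum_comp finProdFinEquiv, Fintype.sum_prod_type]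
  refine Finset.sum_congr rfl fun b _ => Finset.sum_congr rfl fun r _ => ?_
  have hr := r.2
  have hL : 0 < L := by omega
  rw [finProdFinEquiv_apply_val, Nat.add_mul_div_left _ _ hL, Nat.add_mul_mod_self_left,
    Nat.div_eq_of_lt hr, Nat.mod_eq_of_lt hr, zero_add]

theorem star_dftKernel_mul (N r a b : ℕ) :
    star (dftKernel N r a) * dftKernel N r b = (N : ℂ)⁻¹ *
      Complex.exp (2 * Real.pi * Complex.I * (((a : ℤ) - (b : ℤ) : ℤ) : ℂ) / N) ^ r := by
  unfold dftKernel
  rw [star_mul', ← Complex.exp_nat_mul]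
  simp only [Complex.star_def, Complex.conj_ofReal]
  rw [← Complex.exp_conj, mul_mul_mul_comm, ← Complex.exp_add, ← Complex.ofReal_mul]
  congr 1
  · rw [one_div, ← mul_inv, Real.mul_self_sqrt (Nat.cast_nonneg _)]
    simp
  · congr 1
    simp only [map_div₀, map_neg, map_mul, map_ofNat, Complex.conj_ofReal, Complex.conj_I,
      map_natCast]
    push_cast
    ring

theorem sum_star_dftKernel_mul {N a b : ℕ} (ha : a < N) (hb : b < N) :
    ∑ r : Fin N, star (dftKernel N r a) * dftKernel N r b = if a = b then 1 else 0 := by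
  have hN : (N : ℂ) ≠ 0 := by
    have : N ≠ 0 := by omega
    exact_mod_cast this
  simp_rw [star_dftKernel_mul, ← Finset.mul_sum]
  rw [← Finset.sum_range fun r => Complex.exp
    (2 * Real.pi * Complex.I * (((a : ℤ) - (b : ℤ) : ℤ) : ℂ) / N) ^ r]
  split_ifs with h
  · subst h
    simp [hN]
  · have hz : Complex.exp (2 * Real.pi * Complex.I * (((a : ℤ) - (b : ℤ) : ℤ) : ℂ) / N) ≠ 1 := by
      intro h1
      obtain ⟨n, hn⟩ := Complex.exp_eq_one_iff.1 h1
      have h2 : (((a : ℤ) - (b : ℤ) : ℤ) : ℂ) = ((n * N : ℤ) : ℂ) := by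
        have hp := Complex.two_pi_I_ne_zero
        rw [div_eq_iff hN] at hn
        apply mul_left_cancel₀ hp
        rw [hn]
        push_cast
        ring
      have h3 : (a : ℤ) - b = n * N := by exact_mod_cast h2
      have h4 : ((a : ℤ) - b).natAbs < N := by omega
      have h5 : (N : ℤ) ∣ (a : ℤ) - b := ⟨n, by rw [h3]; ring⟩
      have := Int.eq_zero_of_dvd_of_natAbs_lt_natAbs h5 (by simpa using h4)
      omega
    rw [geom_sum_eq hz, ← Complex.exp_nat_mul]
    have h6 : (N : ℂ) * (2 * Real.pi * Complex.I * (((a : ℤ) - (b : ℤ) : ℤ) : ℂ) / N)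
        = (((a : ℤ) - (b : ℤ) : ℤ) : ℂ) * (2 * Real.pi * Complex.I) := by
      field_simp
    rw [h6, Complex.exp_int_mul_two_pi_mul_I]
    simp

theorem dft_conjTranspose_mul (N : ℕ) : (dft N).conjTranspose * dft N = 1 := by
  ext a b
  rw [Matrix.mul_apply]
  simp only [Matrix.conjTranspose_apply, dft, Matrix.of_apply]
  rw [sum_star_dftKernel_mul a.2 b.2]
  simp [Matrix.one_apply, Fin.ext_iff]

theorem dft_mul_conjTranspose (N : ℕ) : dft N * (dft N).conjTranspose = 1 :=
  mul_eq_one_comm.1 (dft_conjTranspose_mul N)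

theorem dft_transpose (N : ℕ) : (dft N).transpose = dft N := by
  ext a b
  exact dftKernel_comm _ _ _

theorem norm_le_one_of_conjTranspose_mul {n : Type*} [Fintype n] [DecidableEq n]
    {U : Matrix n n ℂ} (hU : U.conjTranspose * U = 1) : ‖U‖ ≤ 1 := by
  have h1 := Matrix.l2_opNorm_conjTranspose_mul_self U
  have h2 : ‖(1 : Matrix n n ℂ)‖ ≤ 1 := by
    rw [← Matrix.diagonal_one, Matrix.l2_opNorm_diagonal]
    exact (pi_norm_le_iff_of_nonneg zero_le_one).2 fun i => by simp
  rw [hU] at h1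
  nlinarith [norm_nonneg U]

/-- The block diagonal matrix with `M` blocks `𝓕_L`. -/
noncomputable def blockDft (M L : ℕ) : Matrix (Fin (M * L)) (Fin (M * L)) ℂ :=
  Matrix.of fun i j => if (i : ℕ) / L = (j : ℕ) / L
    then dftKernel L ((i : ℕ) % L) ((j : ℕ) % L) else 0

theorem blockDft_conjTranspose_mul (M L : ℕ) : (blockDft M L).conjTranspose * blockDft M L = 1 := by
  ext a b
  have hL : 0 < L := Nat.pos_of_ne_zero fun h => by
    have := a.2
    simp [h] at this
  have ha : (a : ℕ) / L < M := Nat.div_lt_of_lt_mul (a.2.trans_eq (mul_comm M L))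
  rw [Matrix.mul_apply]
  simp only [Matrix.conjTranspose_apply, blockDft, Matrix.of_apply]
  rw [sum_fin_mul M L fun p r => star (if p = (a : ℕ) / L then dftKernel L r ((a : ℕ) % L) else 0) *
    if p = (b : ℕ) / L then dftKernel L r ((b : ℕ) % L) else 0]
  rw [Finset.sum_eq_single ⟨(a : ℕ) / L, ha⟩]
  · by_cases h : (a : ℕ) / L = (b : ℕ) / L
    · simp only [if_true, h]
      rw [sum_star_dftKernel_mul (Nat.mod_lt _ hL) (Nat.mod_lt _ hL)]
      simp only [Matrix.one_apply, Fin.ext_iff]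
      refine if_congr ⟨fun h1 => ?_, fun h1 => by rw [h1]⟩ rfl rfl
      rw [← Nat.div_add_mod (a : ℕ) L, ← Nat.div_add_mod (b : ℕ) L, h, h1]
    · have hab : a ≠ b := fun h1 => h (by rw [h1])
      simp [h, hab]
  · intro p _ hp
    have : (p : ℕ) ≠ (a : ℕ) / L := fun h => hp (Fin.ext h)
    simp [this]
  · simp

theorem blockMatrix_eq {M : ℕ} (hM : 0 < M) (L : ℕ) (χ : ℝ → ℝ) :
    blockMatrix M (M * L) χ = Matrix.diagonal (fun i : Fin (M * L) => discretize χ L ((i : ℕ) % L)) *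
      blockDft M L * Matrix.diagonal (fun i : Fin (M * L) => discretize χ L ((i : ℕ) % L)) := by
  ext i j
  rw [Matrix.mul_diagonal, Matrix.diagonal_mul]
  simp only [blockMatrix, blockDft, Matrix.of_apply, Nat.mul_div_cancel_left L hM]
  split_ifs <;> simp

theorem norm_diagonal_le_one {n : Type*} [Fintype n] [DecidableEq n] {v : n → ℂ}
    (hv : ∀ i, ‖v i‖ ≤ 1) : ‖Matrix.diagonal v‖ ≤ 1 := by
  rw [Matrix.l2_opNorm_diagonal]
  exact (pi_norm_le_iff_of_nonneg zero_le_one).2 hv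

theorem norm_mul_le_one {n : Type*} [Fintype n] [DecidableEq n] {A B : Matrix n n ℂ}
    (hA : ‖A‖ ≤ 1) (hB : ‖B‖ ≤ 1) : ‖A * B‖ ≤ 1 :=
  (norm_mul_le A B).trans (mul_le_one₀ hA (norm_nonneg _) hB)

theorem norm_bakerMatrix_le_one {M : ℕ} (hM : 0 < M) (L : ℕ) (A : Finset ℕ) {χ : ℝ → ℝ}
    (hχ_range : ∀ x, χ x ∈ Set.Icc (0 : ℝ) 1) : ‖bakerMatrix M (M * L) A χ‖ ≤ 1 := by
  have hd : ‖Matrix.diagonal (fun i : Fin (M * L) => discretize χ L ((i : ℕ) % L))‖ ≤ 1 :=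
    norm_diagonal_le_one fun i => by
      obtain ⟨h0, h1⟩ := hχ_range ((((i : ℕ) % L : ℕ) : ℝ) / L)
      rw [discretize, Complex.norm_real, Real.norm_eq_abs, abs_of_nonneg h0]
      exact h1
  rw [bakerMatrix, blockMatrix_eq hM]
  refine norm_mul_le_one (norm_mul_le_one ?_ (norm_mul_le_one (norm_mul_le_one hd ?_) hd)) ?_
  · rw [Matrix.l2_opNorm_conjTranspose]
    exact norm_le_one_of_conjTranspose_mul (dft_conjTranspose_mul _)
  · exact norm_le_one_of_conjTranspose_mul (blockDft_conjTranspose_mul M L)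
  · exact norm_diagonal_le_one fun i => by split_ifs <;> simp

theorem norm_apply_le_norm {n : Type*} [Fintype n] [DecidableEq n] (A : Matrix n n ℂ) (i j : n) :
    ‖A i j‖ ≤ ‖A‖ := by
  have h := Matrix.l2_opNorm_mulVec A (EuclideanSpace.single j (1 : ℂ))
  have h2 := PiLp.norm_apply_le ((EuclideanSpace.equiv n ℂ).symm <|
    A.mulVec (EuclideanSpace.single j (1 : ℂ))) i
  rw [PiLp.norm_single, norm_one, mul_one] at h
  refine le_trans (le_of_eq ?_) (h2.trans h)
  simp

theorem norm_toEuclideanLin_le {n : Type*} [Fintype n] [DecidableEq n] (A : Matrix n n ℂ)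
    (x : EuclideanSpace ℂ n) : ‖Matrix.toEuclideanLin A x‖ ≤ ‖A‖ * ‖x‖ :=
  Matrix.l2_opNorm_mulVec A x

/-- Cauchy–Schwarz in each row. The loss of the dimension is harmless against rapid decay. -/
theorem norm_le_card_mul_of_norm_apply_le {n : Type*} [Fintype n] [DecidableEq n] {A : Matrix n n ℂ}
    {c : ℝ} (hc : 0 ≤ c) (hA : ∀ i j, ‖A i j‖ ≤ c) : ‖A‖ ≤ Fintype.card n * c := by
  refine ContinuousLinearMap.opNorm_le_bound _ (by positivity) fun x => ?_
  change ‖Matrix.toEuclideanLin A x‖ ≤ _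
  have h1 : ∀ i, ‖(Matrix.toEuclideanLin A x) i‖ ≤ c * ∑ j, ‖x j‖ := by
    intro i
    rw [Matrix.toLpLin_apply]
    simp only [Matrix.mulVec, dotProduct, Finset.mul_sum]
    exact norm_sum_le_of_le _ fun j _ => by
      rw [norm_mul]; exact mul_le_mul_of_nonneg_right (hA i j) (norm_nonneg _)
  have h2 : (∑ j, ‖x j‖) ^ 2 ≤ Fintype.card n * ‖x‖ ^ 2 := by
    rw [EuclideanSpace.norm_sq_eq]
    exact sq_sum_le_card_mul_sum_sq
  refine abs_le_of_sq_le_sq' ?_ (by positivity) |>.2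
  rw [EuclideanSpace.norm_sq_eq]
  calc ∑ i, ‖(Matrix.toEuclideanLin A x) i‖ ^ 2 ≤ ∑ i : n, (c * ∑ j, ‖x j‖) ^ 2 :=
        Finset.sum_le_sum fun i _ => pow_le_pow_left₀ (norm_nonneg _) (h1 i) 2
    _ = Fintype.card n * (c ^ 2 * (∑ j, ‖x j‖) ^ 2) := by
        rw [Finset.sum_const, Finset.card_univ, nsmul_eq_mul, mul_pow]
    _ ≤ Fintype.card n * (c ^ 2 * (Fintype.card n * ‖x‖ ^ 2)) := by gcongr
    _ = _ := by ring

/-! ### Entries of the baker's map. -/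

theorem bakerMatrix_apply_eq_zero {M : ℕ} (hM : 0 < M) {L : ℕ} {A : Finset ℕ} (χ : ℝ → ℝ)
    (j : Fin (M * L)) {l : Fin (M * L)} (hl : (l : ℕ) / L ∉ A) :
    bakerMatrix M (M * L) A χ j l = 0 := by
  rw [bakerMatrix, alphabetMatrix, Matrix.mul_diagonal, Nat.mul_div_cancel_left L hM, if_neg hl,
    mul_zero]

/-- Within one block the outer inverse transform and the inner transform combine into a pure
exponential in the position `r`, whose frequency measures the distance from the graph of the
expanding map. -/
theorem star_dftKernel_mul_dftKernel {M L : ℕ} (hM : 0 < M) (hL : 0 < L) (a r j l : ℕ) :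
    star (dftKernel (M * L) (r + L * a) j) * dftKernel L r l =
      star (dftKernel (M * L) (L * a) j) * ((1 / Real.sqrt (L : ℝ) : ℝ) : ℂ) *
        Complex.exp (Complex.I *
          ((2 * Real.pi * ((j : ℝ) / ((M * L : ℕ) : ℝ) - (l : ℝ) / L) : ℝ) : ℂ)) ^ r := by
  have hM' : (M : ℂ) ≠ 0 := by exact_mod_cast hM.ne'
  have hL' : (L : ℂ) ≠ 0 := by exact_mod_cast hL.ne'
  unfold dftKernel
  rw [star_mul', star_mul', ← Complex.exp_nat_mul]
  simp only [Complex.star_def, Complex.conj_ofReal]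
  rw [← Complex.exp_conj, ← Complex.exp_conj]
  have e : ∀ p q x y z w : ℂ, x + y = z + w →
      p * Complex.exp x * (q * Complex.exp y) = p * Complex.exp z * q * Complex.exp w := by
    intro p q x y z w h
    rw [mul_mul_mul_comm, ← Complex.exp_add, h, Complex.exp_add]
    ring
  apply e
  simp only [map_div₀, map_neg, map_mul, map_ofNat, Complex.conj_ofReal, Complex.conj_I,
      map_natCast]
  push_cast
  field_simp
  ring

theorem bakerMatrix_apply_eq {M : ℕ} (hM : 0 < M) {L : ℕ} (hL : 0 < L) {A : Finset ℕ} (χ : ℝ → ℝ)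
    (j : Fin (M * L)) {l : Fin (M * L)} (hl : (l : ℕ) / L ∈ A) :
    bakerMatrix M (M * L) A χ j l = star (dftKernel (M * L) (L * ((l : ℕ) / L)) j) *
      ((1 / Real.sqrt (L : ℝ) : ℝ) : ℂ) * discretize χ L ((l : ℕ) % L) *
      ∑ r ∈ Finset.range L, (χ ((r : ℝ) / L) : ℂ) * Complex.exp (Complex.I *
        ((2 * Real.pi * ((j : ℕ) / ((M * L : ℕ) : ℝ) - (((l : ℕ) % L : ℕ) : ℝ) / L) : ℝ) : ℂ)) ^ r := by
  have ha : (l : ℕ) / L < M := Nat.div_lt_of_lt_mul (l.2.trans_eq (mul_comm M L))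
  rw [bakerMatrix, alphabetMatrix, Matrix.mul_diagonal, Nat.mul_div_cancel_left L hM, if_pos hl,
    mul_one, Matrix.mul_apply]
  simp only [Matrix.conjTranspose_apply, dft, blockMatrix, Matrix.of_apply,
    Nat.mul_div_cancel_left L hM]
  have h2 : ∀ i : Fin (M * L), star (dftKernel (M * L) (i : ℕ) j) =
      star (dftKernel (M * L) ((i : ℕ) % L + L * ((i : ℕ) / L)) j) := fun i => by
    rw [Nat.mod_add_div]
  simp_rw [h2]
  rw [sum_fin_mul M L fun p r => star (dftKernel (M * L) (r + L * p) j) *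
    if p = (l : ℕ) / L then discretize χ L r * dftKernel L r ((l : ℕ) % L) *
      discretize χ L ((l : ℕ) % L) else 0]
  rw [Finset.sum_eq_single ⟨(l : ℕ) / L, ha⟩]
  · simp only [if_true]
    rw [← Finset.sum_range fun r => star (dftKernel (M * L) (r + L * ((l : ℕ) / L)) j) *
      (discretize χ L r * dftKernel L r ((l : ℕ) % L) * discretize χ L ((l : ℕ) % L)),
      Finset.mul_sum]
    refine Finset.sum_congr rfl fun r _ => ?_
    have h3 := star_dftKernel_mul_dftKernel hM hL ((l : ℕ) / L) r j ((l : ℕ) % L)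
    calc _ = (star (dftKernel (M * L) (r + L * ((l : ℕ) / L)) j) * dftKernel L r ((l : ℕ) % L)) *
          discretize χ L ((l : ℕ) % L) * discretize χ L r := by ring
      _ = _ := by rw [h3]; unfold discretize; ring
  · intro p _ hp
    have : (p : ℕ) ≠ (l : ℕ) / L := fun h => hp (Fin.ext h)
    simp [this]
  · simp

theorem norm_dftKernel (N a b : ℕ) : ‖dftKernel N a b‖ = 1 / Real.sqrt N := by
  have h : -(2 * (Real.pi : ℂ) * Complex.I * (a : ℂ) * (b : ℂ)) / (N : ℂ)
      = ((-(2 * Real.pi * a * b) / N : ℝ) : ℂ) * Complex.I := by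
    push_cast
    ring
  rw [dftKernel, norm_mul, h, Complex.norm_exp_ofReal_mul_I, mul_one, Complex.norm_real,
    Real.norm_eq_abs, abs_of_nonneg (by positivity)]

/-- Rapid decay of the entries of the baker's map away from the graph of the expanding map. -/
theorem exists_norm_bakerMatrix_apply_le {χ : ℝ → ℝ}
    (hχ_smooth : ContDiff ℝ ((⊤ : ℕ∞) : WithTop ℕ∞) χ)
    (hχ_supp : tsupport χ ⊆ Set.Ioo (0 : ℝ) 1)
    (hχ_range : ∀ x, χ x ∈ Set.Icc (0 : ℝ) 1) (m : ℕ) :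
    ∃ K : ℝ, 0 ≤ K ∧ ∀ M L : ℕ, 0 < M → 0 < L → ∀ (A : Finset ℕ) (j l : Fin (M * L)),
      (L * |(j : ℕ) / ((M * L : ℕ) : ℝ) - (((l : ℕ) % L : ℕ) : ℝ) / L|) ^ m *
        ‖bakerMatrix M (M * L) A χ j l‖ ≤ K := by
  obtain ⟨K, hK, hsum⟩ := exists_norm_sum_le hχ_smooth hχ_supp m
  refine ⟨K, hK, fun M L hM hL A j l => ?_⟩
  by_cases hl : (l : ℕ) / L ∈ A
  swap
  · rw [bakerMatrix_apply_eq_zero hM χ j hl]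
    simpa using hK
  rw [bakerMatrix_apply_eq hM hL χ j hl]
  by_cases hx : χ ((((l : ℕ) % L : ℕ) : ℝ) / L) = 0
  · simpa [discretize, hx] using hK
  have hL' : (0 : ℝ) < L := by exact_mod_cast hL
  have hN' : (0 : ℝ) < ((M * L : ℕ) : ℝ) := by exact_mod_cast Nat.mul_pos hM hL
  have hLN : (L : ℝ) ≤ ((M * L : ℕ) : ℝ) := by exact_mod_cast Nat.le_mul_of_pos_left L hM
  have hy : (j : ℕ) / ((M * L : ℕ) : ℝ) ∈ Set.Icc (0 : ℝ) 1 :=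
    ⟨by positivity, (div_le_one hN').2 (by exact_mod_cast j.2.le)⟩
  have h := hsum L hL _ _ hx hy
  rw [norm_mul, norm_mul, norm_mul, norm_star, norm_dftKernel, Complex.norm_real, Real.norm_eq_abs,
    abs_of_nonneg (by positivity : (0 : ℝ) ≤ 1 / Real.sqrt L)]
  have h1 : ‖discretize χ L ((l : ℕ) % L)‖ ≤ 1 := by
    obtain ⟨h0, h1⟩ := hχ_range ((((l : ℕ) % L : ℕ) : ℝ) / L)
    rw [discretize, Complex.norm_real, Real.norm_eq_abs, abs_of_nonneg h0]
    exact h1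
  -- The two Fourier normalizations together cancel the factor `L` in the bound for the exponential
  -- sum.
  have h2 : 1 / Real.sqrt ((M * L : ℕ) : ℝ) * (1 / Real.sqrt L) ≤ 1 / L := by
    calc _ ≤ 1 / Real.sqrt L * (1 / Real.sqrt L) := by
          have := Real.sqrt_pos.2 hL'
          gcongr
      _ = 1 / L := by rw [div_mul_div_comm, one_mul, Real.mul_self_sqrt hL'.le]
  have h3 : 1 / Real.sqrt ((M * L : ℕ) : ℝ) * (1 / Real.sqrt L) *
      ‖discretize χ L ((l : ℕ) % L)‖ ≤ 1 / L :=
    (mul_le_of_le_one_right (by positivity) h1).trans h2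
  calc _ = (1 / Real.sqrt ((M * L : ℕ) : ℝ) * (1 / Real.sqrt L) *
        ‖discretize χ L ((l : ℕ) % L)‖) * (_ * ‖_‖) := mul_left_comm _ _ _
    _ ≤ 1 / L * (K * L) := mul_le_mul h3 h (by positivity) (by positivity)
    _ = K := by field_simp

/-! ### Propagation along the expanding map. -/

/-- The diagonal matrix of multiplication by the indicator function of `X`. -/
noncomputable def cutMatrix {N : ℕ} (X : Set (Fin N)) : Matrix (Fin N) (Fin N) ℂ :=
  Matrix.diagonal (X.indicator fun _ => 1)

theorem toEuclideanLin_cutMatrix {N : ℕ} (X : Set (Fin N)) (u : ell2 N) :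
    Matrix.toEuclideanLin (cutMatrix X) u = cutTo X u := by
  classical
  ext i
  rw [Matrix.toLpLin_apply]
  simp [cutMatrix, cutTo, Matrix.mulVec_diagonal, Set.indicator_apply]

theorem norm_cutMatrix_le_one {N : ℕ} (X : Set (Fin N)) : ‖cutMatrix X‖ ≤ 1 :=
  norm_diagonal_le_one fun i => by
    classical
    rw [Set.indicator_apply]
    split_ifs <;> simp

theorem cutMatrix_add_compl {N : ℕ} (X : Set (Fin N)) : cutMatrix X + cutMatrix Xᶜ = 1 := by
  rw [cutMatrix, cutMatrix, Matrix.diagonal_add, ← Matrix.diagonal_one]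
  congr 1
  ext i
  exact congrFun (Set.indicator_self_add_compl X fun _ => (1 : ℂ)) i

theorem cutMatrix_mul_of_subset {N : ℕ} {X Y : Set (Fin N)} (h : X ⊆ Y) :
    cutMatrix Y * cutMatrix X = cutMatrix X := by
  classical
  rw [cutMatrix, cutMatrix, Matrix.diagonal_mul_diagonal]
  congr 1
  ext i
  simp only [Set.indicator_apply]
  by_cases h1 : i ∈ X
  · simp [h1, h h1]
  · simp [h1]

theorem norm_pow_le_one {n : Type*} [Fintype n] [DecidableEq n] {B : Matrix n n ℂ} (hB : ‖B‖ ≤ 1)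
    (i : ℕ) : ‖B ^ i‖ ≤ 1 := by
  induction i with
  | zero => rw [pow_zero, ← Matrix.diagonal_one]; exact norm_diagonal_le_one fun _ => by simp
  | succ i ih => rw [pow_succ]; exact norm_mul_le_one ih hB

/-- The points that reach the whole torus in `i` steps of the expanding map along the alphabet,
up to an error `r` at each step. -/
def orbitSet (M L : ℕ) (A : Finset ℕ) (r : ℝ) : ℕ → Set (Fin (M * L))
  | 0 => Set.univ
  | i + 1 => {l | (l : ℕ) / L ∈ A ∧ ∃ j ∈ orbitSet M L A r i,
      |(j : ℕ) / ((M * L : ℕ) : ℝ) - (((l : ℕ) % L : ℕ) : ℝ) / L| < r}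

theorem norm_bakerMatrix_pow_mul_cut_le {M : ℕ} (hM : 0 < M) (L : ℕ) (A : Finset ℕ) {χ : ℝ → ℝ}
    (hχ_range : ∀ x, χ x ∈ Set.Icc (0 : ℝ) 1) {r ε : ℝ} (hε : 0 ≤ ε)
    (hB : ∀ j l : Fin (M * L),
      r ≤ |(j : ℕ) / ((M * L : ℕ) : ℝ) - (((l : ℕ) % L : ℕ) : ℝ) / L| →
        ‖bakerMatrix M (M * L) A χ j l‖ ≤ ε) (i : ℕ) :
    ‖bakerMatrix M (M * L) A χ ^ i * cutMatrix (orbitSet M L A r i)ᶜ‖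
      ≤ i * (((M * L : ℕ) : ℝ) * ε) := by
  have hB1 := norm_bakerMatrix_le_one hM L A hχ_range
  set B := bakerMatrix M (M * L) A χ with hBdef
  induction i with
  | zero => simp [orbitSet, cutMatrix]
  | succ i ih =>
    set Y := orbitSet M L A r i
    set Y' := orbitSet M L A r (i + 1) with hY'
    -- Split the identity by `Y` after the first application of `B`. A passage from `Y'ᶜ` to `Y` is
    -- a forbidden step with small entries; what lands in `Yᶜ` is covered by induction.
    have h1 : B ^ (i + 1) * cutMatrix Y'ᶜ = B ^ i * (cutMatrix Y * B * cutMatrix Y'ᶜ) +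
        B ^ i * cutMatrix Yᶜ * (B * cutMatrix Y'ᶜ) := by
      calc _ = B ^ i * 1 * (B * cutMatrix Y'ᶜ) := by rw [pow_succ, mul_one, mul_assoc]
        _ = _ := by rw [← cutMatrix_add_compl Y]; noncomm_ring
    have h2 : ‖cutMatrix Y * B * cutMatrix Y'ᶜ‖ ≤ ((M * L : ℕ) : ℝ) * ε := by
      have := norm_le_card_mul_of_norm_apply_le (A := cutMatrix Y * B * cutMatrix Y'ᶜ) hε ?_
      · simpa using this
      · intro j l
        classical
        rw [cutMatrix, cutMatrix, Matrix.mul_diagonal, Matrix.diagonal_mul, Set.indicator_apply,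
          Set.indicator_apply]
        by_cases hj : j ∈ Y
        swap
        · simpa [hj] using hε
        by_cases hl : l ∈ Y'
        · simpa [hl] using hε
        rw [if_pos hj, if_pos (Set.mem_compl hl), one_mul, mul_one]
        by_cases ha : (l : ℕ) / L ∈ A
        · exact hB j l (not_lt.1 fun h => hl ⟨ha, j, hj, h⟩)
        · rw [hBdef, bakerMatrix_apply_eq_zero hM χ j ha]
          simpa using hε
    rw [h1]
    calc _ ≤ ‖B ^ i‖ * ‖cutMatrix Y * B * cutMatrix Y'ᶜ‖ +
          ‖B ^ i * cutMatrix Yᶜ‖ * ‖B * cutMatrix Y'ᶜ‖ :=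
          (norm_add_le _ _).trans (add_le_add (norm_mul_le _ _) (norm_mul_le _ _))
      _ ≤ 1 * (((M * L : ℕ) : ℝ) * ε) + i * (((M * L : ℕ) : ℝ) * ε) * 1 := by
          have h3 := norm_mul_le_one hB1 (norm_cutMatrix_le_one Y'ᶜ)
          exact add_le_add (mul_le_mul (norm_pow_le_one hB1 i) h2 (norm_nonneg _) zero_le_one)
            (mul_le_mul ih h3 (norm_nonneg _) (by positivity))
      _ = _ := by push_cast; ring

/-! ### Cantor sets and the geometry of the orbit sets. -/

theorem zero_mem_cantor (M : ℕ) (A : Finset ℕ) : 0 ∈ cantor M A 0 :=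
  ⟨fun i => i.elim0, fun i => i.elim0, by simp⟩

/-- A new leading digit, as when passing to a preimage under the expanding map. -/
theorem add_mul_pow_mem_cantor {M : ℕ} {A : Finset ℕ} {i w a : ℕ} (hw : w ∈ cantor M A i)
    (ha : a ∈ A) : w + a * M ^ i ∈ cantor M A (i + 1) := by
  obtain ⟨d, hd, rfl⟩ := hw
  refine ⟨Fin.snoc (α := fun _ => ℕ) d a, fun j => ?_, ?_⟩
  · refine Fin.lastCases ?_ (fun j => ?_) j
    · simpa using ha
    · simpa using hd j
  · simp [Fin.sum_univ_castSucc]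

/-- A new lowest digit, as when refining a cylinder. -/
theorem add_mul_mem_cantor {M : ℕ} {A : Finset ℕ} {i w a : ℕ} (hw : w ∈ cantor M A i)
    (ha : a ∈ A) : a + M * w ∈ cantor M A (i + 1) := by
  obtain ⟨d, hd, rfl⟩ := hw
  refine ⟨Fin.cons (α := fun _ => ℕ) a d, fun j => ?_, ?_⟩
  · refine Fin.cases ?_ (fun j => ?_) j
    · simpa using ha
    · simpa using hd j
  · simp only [Fin.sum_univ_succ, Fin.cons_zero, Fin.cons_succ, Fin.val_zero, Fin.val_succ,
      pow_zero, mul_one, Finset.mul_sum]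
    congr 1
    refine Finset.sum_congr rfl fun j _ => ?_
    ring

theorem lt_of_mem_cantor {M : ℕ} {A : Finset ℕ} (hA : A ⊆ Finset.range M) {i w : ℕ}
    (hw : w ∈ cantor M A i) : w < M ^ i := by
  obtain ⟨d, hd, rfl⟩ := hw
  induction i with
  | zero => simp
  | succ i ih =>
    have h1 := ih (fun j => d j.castSucc) fun j => hd _
    have h2 := Finset.mem_range.1 (hA (hd (Fin.last i)))
    rw [Fin.sum_univ_castSucc]
    simp only [Fin.val_castSucc, Fin.val_last]
    have h3 : (d (Fin.last i) + 1) * M ^ i ≤ M * M ^ i := Nat.mul_le_mul_right _ h2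
    rw [pow_succ']
    linarith

/-- Append the same letter `d` times as lowest digits: every cylinder of depth `i` contains a Cantor
point of depth `i + d`. -/
theorem exists_mem_cantor_add {M : ℕ} {A : Finset ℕ} (hA : A ⊆ Finset.range M)
    (hA0 : A.Nonempty) {i w : ℕ} (hw : w ∈ cantor M A i) (d : ℕ) :
    ∃ j ∈ cantor M A (i + d), w * M ^ d ≤ j ∧ j + 1 ≤ (w + 1) * M ^ d := by
  obtain ⟨a, ha⟩ := hA0
  have haM := Finset.mem_range.1 (hA ha)
  induction d with
  | zero => exact ⟨w, hw, by simp⟩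
  | succ d ih =>
    obtain ⟨j, hj, h1, h2⟩ := ih
    refine ⟨a + M * j, add_mul_mem_cantor hj ha, ?_, ?_⟩
    · have := Nat.mul_le_mul_left M h1
      rw [pow_succ]
      linarith
    · have := Nat.mul_le_mul_left M h2
      rw [pow_succ]
      linarith

/-- Points of `orbitSet` lie near a cylinder interval of the Cantor set. -/
theorem exists_cantor_of_mem_orbitSet {M L : ℕ} (hM : 2 ≤ M) (hL : 0 < L) {A : Finset ℕ} {s : ℝ}
    (hs : 0 ≤ s) {i : ℕ} {l : Fin (M * L)} (hl : l ∈ orbitSet M L A (M * s) i) :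
    ∃ w ∈ cantor M A i, ∃ x : ℝ, (w : ℝ) ≤ x ∧ x ≤ w + 1 ∧
      |(l : ℕ) / ((M * L : ℕ) : ℝ) - x / (M : ℝ) ^ i| ≤ 2 * s := by
  have hM' : (2 : ℝ) ≤ M := by exact_mod_cast hM
  have hL' : (0 : ℝ) < L := by exact_mod_cast hL
  induction i generalizing l with
  | zero =>
    refine ⟨0, zero_mem_cantor M A, (l : ℕ) / ((M * L : ℕ) : ℝ), ?_, ?_, ?_⟩
    · rw [Nat.cast_zero]; positivity
    · rw [Nat.cast_zero, zero_add]
      exact div_le_one_of_le₀ (by exact_mod_cast l.2.le) (Nat.cast_nonneg _)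
    · simpa using hs
  | succ i ih =>
    obtain ⟨ha, j, hj, hjl⟩ := hl
    obtain ⟨w, hw, x, hx1, hx2, hjx⟩ := ih hj
    refine ⟨w + (l : ℕ) / L * M ^ i, add_mul_pow_mem_cantor hw ha, x + ((l : ℕ) / L : ℕ) * M ^ i,
      ?_, ?_, ?_⟩
    · push_cast; linarith
    · push_cast; linarith
    · have h1 : ((l : ℕ) : ℝ) = L * ((l : ℕ) / L : ℕ) + ((l : ℕ) % L : ℕ) := by
        exact_mod_cast (Nat.div_add_mod (l : ℕ) L).symm
      set a := (((l : ℕ) / L : ℕ) : ℝ)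
      set t := (((l : ℕ) % L : ℕ) : ℝ)
      set y := ((j : ℕ) : ℝ) / ((M * L : ℕ) : ℝ)
      have h2 : ((l : ℕ) : ℝ) / ((M * L : ℕ) : ℝ) - (x + a * (M : ℝ) ^ i) / (M : ℝ) ^ (i + 1) =
          (-(y - t / L) + (y - x / (M : ℝ) ^ i)) / M := by
        rw [h1, pow_succ]
        push_cast
        field_simp
        ring
      -- The new error `M s` and the old error `2 s` are both divided by `M`; for `M ≥ 2` the result
      -- is again at most `2 s`.
      rw [h2, abs_div, abs_of_pos (by linarith : (0 : ℝ) < M), div_le_iff₀ (by linarith)]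
      have h3 := abs_add_le (-(y - t / L)) (y - x / (M : ℝ) ^ i)
      rw [abs_neg] at h3
      nlinarith

/-- The radius `(M + 2) N^{1-ρ}` is a sum: `2 N^{1-ρ}` from `l` to the cylinder, and the cylinder
length `N / M^i ≤ M N^{1-ρ}` from there to a Cantor point inside it. -/
theorem mem_thickened_of_abs_sub_le {M N : ℕ} (hM : 0 < M) {A : Finset ℕ}
    (hA : A ⊆ Finset.range M) (hA0 : A.Nonempty) {k : ℕ} (hk : M ^ k ≤ N) {ρ : ℝ} {i : ℕ}
    (hik : i ≤ k) (hNi : (N : ℝ) ^ ρ ≤ (M : ℝ) ^ (i + 1)) {l : Fin N} {w : ℕ}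
    (hw : w ∈ cantor M A i) {x : ℝ} (hx1 : (w : ℝ) ≤ x) (hx2 : x ≤ w + 1)
    (hlx : |(l : ℕ) / (N : ℝ) - x / (M : ℝ) ^ i| ≤ 2 * (N : ℝ) ^ (-ρ)) :
    l ∈ thickened M N A k ρ := by
  have hN : (0 : ℝ) < N := by exact_mod_cast (Nat.pow_pos hM).trans_le hk
  have hM' : (0 : ℝ) < M := by exact_mod_cast hM
  obtain ⟨d, rfl⟩ := Nat.exists_eq_add_of_le hik
  obtain ⟨j, hj, hwj, hjw⟩ := exists_mem_cantor_add hA hA0 hw d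
  have hjlt := lt_of_mem_cantor hA hj
  set P : ℝ := (M : ℝ) ^ (i + d) with hP
  have hP0 : 0 < P := by positivity
  have hPN : P ≤ N := by rw [hP]; exact_mod_cast hk
  have hNP : 1 ≤ (N : ℝ) / P := (one_le_div hP0).2 hPN
  have hb1 : (j : ℝ) * N / P ≤ (cantorPoint M N (i + d) j : ℝ) := Nat.le_ceil _
  have hb2 : (cantorPoint M N (i + d) j : ℝ) < j * N / P + 1 := Nat.ceil_lt_add_one (by positivity)
  set b := cantorPoint M N (i + d) j
  have hb3 : (b : ℝ) < (j + 1) * (N / P) := by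
    calc (b : ℝ) < j * N / P + 1 := hb2
      _ ≤ j * N / P + N / P := by linarith
      _ = _ := by ring
  have hbN : b < N := by
    have : (b : ℝ) < N := by
      calc (b : ℝ) < (j + 1) * (N / P) := hb3
        _ ≤ P * (N / P) := by
          refine mul_le_mul_of_nonneg_right ?_ (by positivity)
          rw [hP]; exact_mod_cast hjlt
        _ = N := by field_simp
    exact_mod_cast this
  have hlow : (w : ℝ) * (N / (M : ℝ) ^ i) ≤ b := by
    have h1 : (w : ℝ) * (M : ℝ) ^ d ≤ j := by exact_mod_cast hwj
    calc (w : ℝ) * (N / (M : ℝ) ^ i) = w * (M : ℝ) ^ d * N / P := by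
          rw [hP, pow_add]; field_simp
      _ ≤ j * N / P := by gcongr
      _ ≤ b := hb1
  have hupp : (b : ℝ) ≤ (w + 1) * (N / (M : ℝ) ^ i) := by
    have h1 : (j : ℝ) + 1 ≤ (w + 1) * (M : ℝ) ^ d := by exact_mod_cast hjw
    calc (b : ℝ) ≤ (j + 1) * (N / P) := hb3.le
      _ ≤ ((w + 1) * (M : ℝ) ^ d) * (N / P) := by gcongr
      _ = _ := by rw [hP, pow_add]; field_simp
  refine ⟨⟨b, hbN⟩, ⟨j, hj, rfl⟩, ((l : ℕ) : ℤ) - b, ?_, by simp⟩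
  have hNρ : (N : ℝ) ^ (1 - ρ) = N * (N : ℝ) ^ (-ρ) := by
    rw [sub_eq_add_neg, Real.rpow_add hN, Real.rpow_one]
  have hNM : (N : ℝ) / (M : ℝ) ^ i ≤ M * (N * (N : ℝ) ^ (-ρ)) := by
    rw [Real.rpow_neg hN.le, div_le_iff₀ (by positivity)]
    have h1 : (0 : ℝ) < (N : ℝ) ^ ρ := Real.rpow_pos_of_pos hN ρ
    calc (N : ℝ) = N * ((N : ℝ) ^ ρ)⁻¹ * (N : ℝ) ^ ρ := by field_simp
      _ ≤ N * ((N : ℝ) ^ ρ)⁻¹ * (M : ℝ) ^ (i + 1) := by gcongr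
      _ = _ := by ring
  have hxN : ((l : ℕ) : ℝ) - x * (N / (M : ℝ) ^ i) = N * ((l : ℕ) / (N : ℝ) - x / (M : ℝ) ^ i) := by
    field_simp
  have h1 : |((l : ℕ) : ℝ) - x * (N / (M : ℝ) ^ i)| ≤ 2 * (N * (N : ℝ) ^ (-ρ)) := by
    rw [hxN, abs_mul, abs_of_pos hN]
    linarith [mul_le_mul_of_nonneg_left hlx hN.le]
  have hQ : 0 ≤ (N : ℝ) / (M : ℝ) ^ i := by positivity
  have h2 : |x * (N / (M : ℝ) ^ i) - b| ≤ N / (M : ℝ) ^ i := by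
    rw [abs_le]
    constructor <;> nlinarith
  have h3 := abs_sub_le ((l : ℕ) : ℝ) (x * (N / (M : ℝ) ^ i)) b
  rw [hNρ]
  push_cast
  linarith

theorem orbitSet_subset_thickened {M L : ℕ} (hM : 2 ≤ M) (hL : 0 < L) {A : Finset ℕ}
    (hA : A ⊆ Finset.range M) {k : ℕ} (hk : M ^ k ≤ M * L) {ρ : ℝ} {i : ℕ} (hi0 : 0 < i)
    (hik : i ≤ k) (hNi : ((M * L : ℕ) : ℝ) ^ ρ ≤ (M : ℝ) ^ (i + 1)) :
    orbitSet M L A (M * ((M * L : ℕ) : ℝ) ^ (-ρ)) i ⊆ thickened M (M * L) A k ρ := by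
  intro l hl
  obtain ⟨w, hw, x, hx1, hx2, hlx⟩ :=
    exists_cantor_of_mem_orbitSet hM hL (Real.rpow_nonneg (Nat.cast_nonneg _) (-ρ)) hl
  -- At least one step has been made, so a letter has been used.
  have hA0 : A.Nonempty := by
    obtain ⟨d, hd, -⟩ := hw
    exact ⟨_, hd ⟨0, hi0⟩⟩
  exact mem_thickened_of_abs_sub_le (by omega) hA hA0 hk hik hNi hw hx1 hx2 hlx

/-! ### Eigenstates and Fourier duality. -/

theorem toEuclideanLin_mul_apply {n : Type*} [Fintype n] [DecidableEq n] (A B : Matrix n n ℂ)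
    (x : EuclideanSpace ℂ n) :
    Matrix.toEuclideanLin (A * B) x = Matrix.toEuclideanLin A (Matrix.toEuclideanLin B x) := by
  simp only [Matrix.toLpLin_apply, Matrix.mulVec_mulVec]

theorem toEuclideanLin_one_apply {n : Type*} [Fintype n] [DecidableEq n]
    (x : EuclideanSpace ℂ n) : Matrix.toEuclideanLin (1 : Matrix n n ℂ) x = x := by
  simp only [Matrix.toLpLin_apply, Matrix.one_mulVec]

theorem toEuclideanLin_pow_apply {n : Type*} [Fintype n] [DecidableEq n] {B : Matrix n n ℂ}
    {u : EuclideanSpace ℂ n} {c : ℂ} (hu : Matrix.toEuclideanLin B u = c • u) (t : ℕ) :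
    Matrix.toEuclideanLin (B ^ t) u = c ^ t • u := by
  induction t with
  | zero => rw [pow_zero, pow_zero, one_smul, toEuclideanLin_one_apply]
  | succ t ih => rw [pow_succ, toEuclideanLin_mul_apply, hu, map_smul, ih, smul_smul, pow_succ']

/-- The factor `N` is crude, but costs only one power in the final count. -/
theorem norm_transpose_le {N : ℕ} (E : Matrix (Fin N) (Fin N) ℂ) : ‖E.transpose‖ ≤ N * ‖E‖ := by
  have := norm_le_card_mul_of_norm_apply_le (A := E.transpose) (norm_nonneg E)
    fun i j => norm_apply_le_norm E j i
  simpa using this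

theorem blockMatrix_transpose (M N : ℕ) (χ : ℝ → ℝ) :
    (blockMatrix M N χ).transpose = blockMatrix M N χ := by
  ext i j
  simp only [Matrix.transpose_apply, blockMatrix, Matrix.of_apply]
  by_cases h : (i : ℕ) / (N / M) = (j : ℕ) / (N / M)
  · rw [if_pos h, if_pos h.symm, dftKernel_comm]
    ring
  · rw [if_neg h, if_neg (Ne.symm h)]

theorem blockMatrix_mul_alphabetMatrix_comm (M N : ℕ) (A : Finset ℕ) (χ : ℝ → ℝ) :
    blockMatrix M N χ * alphabetMatrix M N A = alphabetMatrix M N A * blockMatrix M N χ := by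
  ext i j
  rw [alphabetMatrix, Matrix.mul_diagonal, Matrix.diagonal_mul]
  simp only [blockMatrix, Matrix.of_apply]
  by_cases h : (i : ℕ) / (N / M) = (j : ℕ) / (N / M)
  · rw [h, mul_comm]
  · simp [h]

theorem bakerMatrix_transpose (M N : ℕ) (A : Finset ℕ) (χ : ℝ → ℝ) :
    (bakerMatrix M N A χ).transpose =
      blockMatrix M N χ * alphabetMatrix M N A * (dft N).conjTranspose := by
  have h : (dft N).conjTranspose.transpose = (dft N).conjTranspose := by
    rw [Matrix.conjTranspose, dft_transpose, ← Matrix.transpose_map, dft_transpose]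
  rw [bakerMatrix, Matrix.transpose_mul, Matrix.transpose_mul, h, blockMatrix_transpose,
    alphabetMatrix, Matrix.diagonal_transpose, ← alphabetMatrix, ← mul_assoc,
    blockMatrix_mul_alphabetMatrix_comm]

/-- Conjugation by `F` turns `B = F* D` into `D F*`, which is `Bᵀ` because both `D` and `F*` are
symmetric. -/
theorem dft_mul_bakerMatrix_pow (M N : ℕ) (A : Finset ℕ) (χ : ℝ → ℝ) (t : ℕ) :
    dft N * bakerMatrix M N A χ ^ t = (bakerMatrix M N A χ).transpose ^ t * dft N := by
  have h : dft N * bakerMatrix M N A χ = (bakerMatrix M N A χ).transpose * dft N := by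
    rw [bakerMatrix_transpose, mul_assoc _ _ (dft N), dft_conjTranspose_mul, bakerMatrix, mul_one,
      ← mul_assoc, ← mul_assoc, dft_mul_conjTranspose, one_mul]
  exact SemiconjBy.pow_right h t

theorem cutMatrix_transpose {N : ℕ} (X : Set (Fin N)) : (cutMatrix X).transpose = cutMatrix X :=
  Matrix.diagonal_transpose _

theorem norm_pow_mul_norm_le {N : ℕ} {B : Matrix (Fin N) (Fin N) ℂ} {X : Set (Fin N)} {t : ℕ}
    {η : ℝ} (hη : ‖B ^ t * cutMatrix Xᶜ‖ ≤ η) (hB : ‖B ^ t‖ ≤ 1) {c : ℂ} {u : ell2 N}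
    (hu : Matrix.toEuclideanLin B u = c • u) :
    ‖c‖ ^ t * ‖u‖ ≤ ‖cutTo X u‖ + η * ‖u‖ := by
  have h1 : c ^ t • u = Matrix.toEuclideanLin (B ^ t) (cutTo X u) +
      Matrix.toEuclideanLin (B ^ t * cutMatrix Xᶜ) u := by
    rw [← toEuclideanLin_pow_apply hu, ← toEuclideanLin_cutMatrix, ← toEuclideanLin_mul_apply,
      ← LinearMap.add_apply, ← map_add, ← mul_add, cutMatrix_add_compl, mul_one]
  calc ‖c‖ ^ t * ‖u‖ = ‖c ^ t • u‖ := by rw [norm_smul, norm_pow]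
    _ ≤ ‖B ^ t‖ * ‖cutTo X u‖ + ‖B ^ t * cutMatrix Xᶜ‖ * ‖u‖ := by
      rw [h1]
      exact (norm_add_le _ _).trans
        (add_le_add (norm_toEuclideanLin_le _ _) (norm_toEuclideanLin_le _ _))
    _ ≤ 1 * ‖cutTo X u‖ + η * ‖u‖ := by gcongr
    _ = _ := by rw [one_mul]

theorem norm_pow_mul_norm_sub_le {M N : ℕ} {A : Finset ℕ} {χ : ℝ → ℝ} {X : Set (Fin N)} {t : ℕ}
    {η : ℝ} (hη : ‖bakerMatrix M N A χ ^ t * cutMatrix Xᶜ‖ ≤ η) {c : ℂ} {u : ell2 N}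
    (hu : Matrix.toEuclideanLin (bakerMatrix M N A χ) u = c • u) :
    ‖c‖ ^ t * ‖u - Matrix.toEuclideanLin (dft N).conjTranspose
      (cutTo X (Matrix.toEuclideanLin (dft N) u))‖ ≤ N * η * ‖u‖ := by
  have hF : ‖dft N‖ ≤ 1 := norm_le_one_of_conjTranspose_mul (dft_conjTranspose_mul N)
  have h1 : u - Matrix.toEuclideanLin (dft N).conjTranspose
      (cutTo X (Matrix.toEuclideanLin (dft N) u)) =
      Matrix.toEuclideanLin ((dft N).conjTranspose * cutMatrix Xᶜ * dft N) u := by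
    rw [← toEuclideanLin_cutMatrix, ← toEuclideanLin_mul_apply, ← toEuclideanLin_mul_apply,
      sub_eq_iff_eq_add, ← LinearMap.add_apply, ← map_add]
    have : (dft N).conjTranspose * cutMatrix Xᶜ * dft N +
        (dft N).conjTranspose * cutMatrix X * dft N = 1 := by
      rw [← add_mul, ← mul_add, add_comm (cutMatrix Xᶜ), cutMatrix_add_compl, mul_one,
        dft_conjTranspose_mul]
    rw [this, toEuclideanLin_one_apply]
  have h2 : c ^ t • Matrix.toEuclideanLin ((dft N).conjTranspose * cutMatrix Xᶜ * dft N) u =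
      Matrix.toEuclideanLin ((dft N).conjTranspose *
        (bakerMatrix M N A χ ^ t * cutMatrix Xᶜ).transpose * dft N) u := by
    rw [← map_smul, ← toEuclideanLin_pow_apply hu, ← toEuclideanLin_mul_apply,
      Matrix.transpose_mul, Matrix.transpose_pow, cutMatrix_transpose]
    congr 2
    rw [mul_assoc _ (dft N), dft_mul_bakerMatrix_pow]
    noncomm_ring
  rw [h1, ← norm_pow, ← norm_smul, h2]
  refine (norm_toEuclideanLin_le _ _).trans (mul_le_mul_of_nonneg_right ?_ (norm_nonneg _))
  calc _ ≤ ‖(dft N).conjTranspose‖ * ‖(bakerMatrix M N A χ ^ t * cutMatrix Xᶜ).transpose‖ *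
        ‖dft N‖ := (norm_mul_le _ _).trans (mul_le_mul_of_nonneg_right (norm_mul_le _ _)
          (norm_nonneg _))
    _ ≤ 1 * (N * η) * 1 := by
      rw [Matrix.l2_opNorm_conjTranspose]
      have h3 := (norm_transpose_le (bakerMatrix M N A χ ^ t * cutMatrix Xᶜ)).trans
        (mul_le_mul_of_nonneg_left hη (Nat.cast_nonneg N))
      have h4 : 0 ≤ N * η := (norm_nonneg _).trans h3
      gcongr
    _ = _ := by ring

/-- Rapid decay, along the Ehrenfest time `⌈ρ k⌉`, of the baker's map off the thickened Cantor
set. -/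
theorem exists_norm_bakerMatrix_pow_mul_cut_le {ρ : ℝ} (hρ0 : 0 < ρ) (hρ1 : ρ < 1)
    {χ : ℝ → ℝ} (hχ_smooth : ContDiff ℝ ((⊤ : ℕ∞) : WithTop ℕ∞) χ)
    (hχ_supp : tsupport χ ⊆ Set.Ioo (0 : ℝ) 1)
    (hχ_range : ∀ x, χ x ∈ Set.Icc (0 : ℝ) 1) (m : ℕ) :
    ∃ K : ℝ, 0 ≤ K ∧ ∀ (M L : ℕ), 2 ≤ M → 0 < L → ∀ A : Finset ℕ, A ⊆ Finset.range M →
      ∀ k : ℕ, 0 < k → M ^ k ≤ M * L → M * L < M ^ (k + 1) →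
        ‖bakerMatrix M (M * L) A χ ^ ⌈ρ * k⌉₊ * cutMatrix (thickened M (M * L) A k ρ)ᶜ‖ ≤
          ((M * L : ℕ) : ℝ) ^ 2 * (K * (((M * L : ℕ) : ℝ) ^ ((1 - ρ) * m))⁻¹) := by
  obtain ⟨K, hK, hent⟩ := exists_norm_bakerMatrix_apply_le hχ_smooth hχ_supp hχ_range m
  refine ⟨K, hK, fun M L hM hL A hA k hk0 hk1 hk2 => ?_⟩
  have hM0 : 0 < M := by omega
  have hM' : (1 : ℝ) ≤ M := by exact_mod_cast hM0
  have hL' : (0 : ℝ) < L := by exact_mod_cast hL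
  have hN : (0 : ℝ) < ((M * L : ℕ) : ℝ) := by exact_mod_cast Nat.mul_pos hM0 hL
  have hρk : 0 < ρ * k := mul_pos hρ0 (by exact_mod_cast hk0)
  have ht0 : 0 < ⌈ρ * k⌉₊ := Nat.ceil_pos.2 hρk
  have htk : ⌈ρ * k⌉₊ ≤ k := Nat.ceil_le.2 (by nlinarith [(Nat.cast_nonneg k : (0 : ℝ) ≤ k)])
  have hNt : ((M * L : ℕ) : ℝ) ^ ρ ≤ (M : ℝ) ^ (⌈ρ * k⌉₊ + 1) := by
    have h1 : ((M * L : ℕ) : ℝ) ≤ (M : ℝ) ^ (k + 1) := by exact_mod_cast hk2.le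
    calc ((M * L : ℕ) : ℝ) ^ ρ ≤ ((M : ℝ) ^ (k + 1)) ^ ρ := Real.rpow_le_rpow hN.le h1 hρ0.le
      _ = (M : ℝ) ^ (((k + 1 : ℕ) : ℝ) * ρ) := by
        rw [← Real.rpow_natCast, ← Real.rpow_mul (by positivity)]
      -- `(k + 1) ρ ≤ ρ k + 1 ≤ ⌈ρ k⌉ + 1`, by `ρ < 1`.
      _ ≤ (M : ℝ) ^ ((⌈ρ * k⌉₊ + 1 : ℕ) : ℝ) := by
        refine Real.rpow_le_rpow_of_exponent_le hM' ?_
        have := Nat.le_ceil (ρ * k)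
        push_cast
        linarith
      _ = _ := Real.rpow_natCast _ _
  have hsub := orbitSet_subset_thickened hM hL hA hk1 ht0 htk hNt
  set t := ⌈ρ * k⌉₊
  set ε := K * (((M * L : ℕ) : ℝ) ^ ((1 - ρ) * m))⁻¹ with hε
  have hε0 : 0 ≤ ε := by positivity
  have hB := norm_bakerMatrix_pow_mul_cut_le hM0 L A hχ_range
    (r := M * ((M * L : ℕ) : ℝ) ^ (-ρ)) hε0 (fun j l hjl => ?_) t
  · rw [← cutMatrix_mul_of_subset (Set.compl_subset_compl.2 hsub), ← mul_assoc]
    calc _ ≤ _ * _ := norm_mul_le _ _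
      _ ≤ t * (((M * L : ℕ) : ℝ) * ε) * 1 :=
        mul_le_mul hB (norm_cutMatrix_le_one _) (norm_nonneg _) (by positivity)
      _ ≤ ((M * L : ℕ) : ℝ) * (((M * L : ℕ) : ℝ) * ε) * 1 := by
        have h1 : t ≤ M * L := htk.trans ((Nat.lt_pow_self (by omega)).le.trans hk1)
        have h2 : (t : ℝ) ≤ ((M * L : ℕ) : ℝ) := by exact_mod_cast h1
        gcongr
      _ = _ := by ring
  · rw [hε, ← div_eq_mul_inv, le_div_iff₀ (by positivity), mul_comm]
    refine le_trans (mul_le_mul_of_nonneg_right ?_ (norm_nonneg _)) (hent M L hM0 hL A j l)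
    rw [Real.rpow_mul hN.le, Real.rpow_natCast]
    refine pow_le_pow_left₀ (by positivity) ?_ m
    -- The step error was chosen so that `L` times it is exactly `N^{1-ρ}`.
    calc ((M * L : ℕ) : ℝ) ^ (1 - ρ) = L * (M * ((M * L : ℕ) : ℝ) ^ (-ρ)) := by
          rw [sub_eq_add_neg, Real.rpow_add hN, Real.rpow_one]
          push_cast
          ring
      _ ≤ _ := mul_le_mul_of_nonneg_left hjl hL'.le

/-- Rounding up changes the exponent by a number in `[0, 1]`, which costs at most `M ^ ν`; `c ≤ 1`
is not needed. -/
theorem inv_pow_ceil_le {M : ℝ} (hM : 1 ≤ M) {ν c x : ℝ} (hν : 0 < ν) (hc : M ^ (-ν) ≤ c)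
    (hx : 0 ≤ x) : (c ^ ⌈x⌉₊)⁻¹ ≤ M ^ ν * c ^ (-x) := by
  have hM0 : 0 < M := by linarith
  have hc0 : 0 < c := (Real.rpow_pos_of_pos hM0 _).trans_le hc
  have h1 := Nat.le_ceil x
  have h2 := (Nat.ceil_lt_add_one hx).le
  have h3 : M ^ (-ν) ≤ c ^ (⌈x⌉₊ - x) := by
    calc M ^ (-ν) ≤ M ^ (-ν * (⌈x⌉₊ - x)) :=
          Real.rpow_le_rpow_of_exponent_le hM (by nlinarith)
      _ = (M ^ (-ν)) ^ (⌈x⌉₊ - x) := Real.rpow_mul hM0.le _ _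
      _ ≤ _ := Real.rpow_le_rpow (by positivity) hc (by linarith)
  rw [← Real.rpow_natCast, inv_le_iff_one_le_mul₀ (by positivity)]
  calc (1 : ℝ) = M ^ ν * M ^ (-ν) := by rw [← Real.rpow_add hM0]; simp
    _ ≤ M ^ ν * c ^ (⌈x⌉₊ - x) := by gcongr
    _ = M ^ ν * c ^ (-x) * c ^ (⌈x⌉₊ : ℝ) := by
      rw [mul_assoc, ← Real.rpow_add hc0]; ring_nf

theorem inv_pow_le_rpow {M N : ℝ} (hM : 1 ≤ M) {ν c : ℝ} (hν : 0 < ν) (hc : M ^ (-ν) ≤ c) {t : ℕ}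
    (hN : M ^ t ≤ N) : (c ^ t)⁻¹ ≤ N ^ ν := by
  have hM0 : 0 < M := by linarith
  calc (c ^ t)⁻¹ ≤ ((M ^ (-ν)) ^ t)⁻¹ := by gcongr
    _ = (M ^ t) ^ ν := by
      rw [Real.rpow_neg hM0.le, inv_pow, inv_inv, Real.rpow_pow_comm hM0.le]
    _ ≤ N ^ ν := Real.rpow_le_rpow (by positivity) hN hν.le

end OpenBaker

theorem mainTheorem7 (ν ρ : ℝ) (hν : 0 < ν) (hρ0 : 0 < ρ) (hρ1 : ρ < 1)
    (χ : ℝ → ℝ) (hχ_smooth : ContDiff ℝ ((⊤ : ℕ∞) : WithTop ℕ∞) χ)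
    (hχ_supp : tsupport χ ⊆ Set.Ioo (0 : ℝ) 1)
    (hχ_range : ∀ x, χ x ∈ Set.Icc (0 : ℝ) 1) :
    ∀ n : ℕ, ∃ C : ℝ, ∀ (M : ℕ) (A : Finset ℕ), A ⊆ Finset.range M →
      ∀ k N : ℕ, M ∣ N → M ^ k ≤ N → N < M ^ (k + 1) →
      ∀ (lam : ℂ) (u : OpenBaker.ell2 N),
        Matrix.toEuclideanLin (OpenBaker.bakerMatrix M N A χ) u = lam • u →
        (M : ℝ) ^ (-ν) ≤ ‖lam‖ →
        ‖u‖ ≤ (M : ℝ) ^ ν * ‖lam‖ ^ (-(ρ * (k : ℝ))) *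
              ‖OpenBaker.cutTo (OpenBaker.thickened M N A k ρ) u‖
            + C * ((N : ℝ) ^ n)⁻¹ * ‖u‖ ∧
        ‖u - Matrix.toEuclideanLin (OpenBaker.dft N).conjTranspose
              (OpenBaker.cutTo (OpenBaker.thickened M N A k ρ)
                (Matrix.toEuclideanLin (OpenBaker.dft N) u))‖
          ≤ C * ((N : ℝ) ^ n)⁻¹ * ‖u‖ := by
  intro n
  -- The decay `N^{-(1-ρ)m}` must pay for `N^ν` from the eigenvalue, `N^2` from the number of steps
  -- and the matrix size, `N` from the transpose, and the desired `N^{-n}`.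
  obtain ⟨m, hm⟩ := exists_nat_ge ((ν + 3 + n) / (1 - ρ))
  rw [div_le_iff₀ (by linarith), mul_comm] at hm
  obtain ⟨K, hK, hdecay⟩ := OpenBaker.exists_norm_bakerMatrix_pow_mul_cut_le hρ0 hρ1 hχ_smooth
    hχ_supp hχ_range m
  refine ⟨K, ?_⟩
  rintro M A hA k N ⟨L, rfl⟩ hk1 hk2 lam u hu hlam
  have hM : 2 ≤ M := by
    by_contra hc
    obtain rfl | rfl : M = 0 ∨ M = 1 := by omega
    · simp at hk2
    · simp at hk1 hk2; omega
  have hM0 : 0 < M := by omega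
  have hL : 0 < L := Nat.pos_of_ne_zero fun h => by
    subst h
    have : 0 < M ^ k := Nat.pow_pos hM0
    omega
  have hk0 : 0 < k := Nat.pos_of_ne_zero fun h => by
    subst h
    have := Nat.le_mul_of_pos_right M hL
    rw [zero_add, pow_one] at hk2
    omega
  have hM' : (1 : ℝ) ≤ M := by exact_mod_cast hM0
  have hη := hdecay M L hM hL A hA k hk0 hk1 hk2
  have hN1 : (1 : ℝ) ≤ ((M * L : ℕ) : ℝ) := by exact_mod_cast Nat.mul_pos hM0 hL
  have hN0 : (0 : ℝ) < ((M * L : ℕ) : ℝ) := by linarith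
  have h1 := OpenBaker.norm_pow_mul_norm_le hη
    (OpenBaker.norm_pow_le_one (OpenBaker.norm_bakerMatrix_le_one hM0 L A hχ_range) _) hu
  have h2 := OpenBaker.norm_pow_mul_norm_sub_le hη hu
  have hρk : 0 ≤ ρ * k := by positivity
  have htk : ⌈ρ * k⌉₊ ≤ k := Nat.ceil_le.2 (by nlinarith [(Nat.cast_nonneg k : (0 : ℝ) ≤ k)])
  have h3 := OpenBaker.inv_pow_ceil_le hM' hν hlam hρk
  have h4 : (‖lam‖ ^ ⌈ρ * k⌉₊)⁻¹ ≤ ((M * L : ℕ) : ℝ) ^ ν := OpenBaker.inv_pow_le_rpow hM' hν hlam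
    ((pow_le_pow_right₀ hM' htk).trans (by exact_mod_cast hk1))
  have hc : 0 < ‖lam‖ ^ ⌈ρ * k⌉₊ :=
    pow_pos ((Real.rpow_pos_of_pos (by linarith) _).trans_le hlam) _
  generalize M * L = N at *
  set T := ‖lam‖ ^ ⌈ρ * k⌉₊
  have h5 : T⁻¹ * (N * ((N : ℝ) ^ 2 * (K * ((N : ℝ) ^ ((1 - ρ) * m))⁻¹))) ≤ K * ((N : ℝ) ^ n)⁻¹ := by
    have h6 : (N : ℝ) ^ ν * (N : ℝ) ^ 3 * ((N : ℝ) ^ ((1 - ρ) * m))⁻¹ ≤ ((N : ℝ) ^ n)⁻¹ := by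
      rw [← Real.rpow_natCast _ n, ← Real.rpow_natCast _ 3, ← Real.rpow_neg hN0.le,
        ← Real.rpow_neg hN0.le, ← Real.rpow_add hN0, ← Real.rpow_add hN0]
      refine Real.rpow_le_rpow_of_exponent_le hN1 ?_
      push_cast
      linarith
    calc _ = K * (T⁻¹ * (N : ℝ) ^ 3 * ((N : ℝ) ^ ((1 - ρ) * m))⁻¹) := by ring
      _ ≤ K * ((N : ℝ) ^ ν * (N : ℝ) ^ 3 * ((N : ℝ) ^ ((1 - ρ) * m))⁻¹) := by gcongr
      _ ≤ _ := mul_le_mul_of_nonneg_left h6 hK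
  set η := (N : ℝ) ^ 2 * (K * ((N : ℝ) ^ ((1 - ρ) * m))⁻¹)
  have hη0 : 0 ≤ η := by positivity
  constructor
  · calc ‖u‖ = T⁻¹ * (T * ‖u‖) := by field_simp
      _ ≤ T⁻¹ * (‖OpenBaker.cutTo (OpenBaker.thickened M N A k ρ) u‖ + η * ‖u‖) := by gcongr
      _ = T⁻¹ * ‖OpenBaker.cutTo (OpenBaker.thickened M N A k ρ) u‖ + T⁻¹ * (1 * η) * ‖u‖ := by ring
      -- The extra factor `N` is needed only for the second estimate; inserting it here lets `h5`
      -- serve both.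
      _ ≤ T⁻¹ * ‖OpenBaker.cutTo (OpenBaker.thickened M N A k ρ) u‖ + T⁻¹ * (N * η) * ‖u‖ := by
        gcongr
      _ ≤ _ := add_le_add (mul_le_mul_of_nonneg_right h3 (norm_nonneg _))
        (mul_le_mul_of_nonneg_right h5 (norm_nonneg _))
  · calc _ = T⁻¹ * (T * _) := by field_simp
      _ ≤ T⁻¹ * (N * η * ‖u‖) := by gcongr
      _ = T⁻¹ * (N * η) * ‖u‖ := by ring
      _ ≤ _ := mul_le_mul_of_nonneg_right h5 (norm_nonneg _)
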